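/- **Construction.** Fix integers $p,q\ge 1$ with $p+q$ odd. *Half blocks.* A half block with ends $e$ and $b$ has eight further vertices $x_1,\dots,x_8$, and its edges are those of the 5-cycles $e\,x_1x_2x_3x_4$ and $x_3x_5x_6x_7x_8$ (which share the vertex $x_3$) together with $x_4b$, $x_7b$, $x_8b$. *The gadget $H_i$.* Let $a_i,b_i,c_i,d_i$ be distinct vertices. The block $J_i$ is the union of two half blocks (an upper and a lower one) with ends $a_i$ and $b_i$, which have only $a_i$ and $b_i$ in common. The block $L_i$ is likewise the union of an upper and a lower half block with ends $c_i$ and $b_i$ (so $L_i$ is a copy of $J_i$ with $c_i$ in the role of $a_i$). The block $R_i$ is a cycle of odd length $p+q+2$ through $c_i$ and $d_i$, made of an upper $c_i$–$d_i$ path with $p$ inner vertices and a lower $c_i$–$d_i$ path with $q$ inner vertices. The graph $H_i$ is the union of $J_i,L_i,R_i$, where $J_i\cap L_i=\{b_i\}$, $L_i\cap R_i=\{c_i\}$ and $J_i\cap R_i=\emptyset$. Its upper boundary path $P_i$ from $a_i$ to $d_i$ starts at $a_i$, runs through the vertices $x_1,x_2,x_3,x_5,x_6,x_7$ of the upper half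 of $J_i$, then $b_i$, then the vertices $x_7,x_6,x_5,x_3,x_2,x_1$ of the upper half of $L_i$, then $c_i$, and follows the upper path of $R_i$ to $d_i$. The lower boundary path $Q_i$ is defined in the same way from the lower halves and the lower path of $R_i$. *The graph $G_n$.* Take disjoint copies $H_1,\dots,H_n$ of this gadget, identify $d_i$ with $a_{i+1}$ for $1\le i\le n-1$, add two new vertices $x$ and $y$, and join $x$ to every vertex of $P_i$ and $y$ to every vertex of $Q_i$, for all $i\in\{1,\dots,n\}$. **Theorem.** If $n>25$, then $G_n$ is not prism-hamiltonian, i.e. the Cartesian product $G_n\,\square\,K_2$ has no Hamilton cycle. -/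

import Mathlib

namespace PrismCounterexample

/-- The two sides of the plane drawing. -/
inductive Side
  | upper
  | lower

/-- Labels of the eight vertices `x₁, …, x₈` of one half of a block `J` or `L`. -/
inductive X
  | x1 | x2 | x3 | x4 | x5 | x6 | x7 | x8

/-- Vertices of the gadget `H` other than its two ends `a` and `d`. The number `m s` is the number
of inner vertices of the path from `c` to `d` on side `s` of the cycle `R`. -/
inductive Inner (m : Side → ℕ)
  | b
  | c
  | j (s : Side) (k : X)
  | l (s : Side) (k : X)
  | r (s : Side) (k : Fin (m s))

/-- Vertices of the gadget `H`. -/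
inductive HVert (m : Side → ℕ)
  | a
  | d
  | inner (v : Inner m)

namespace HVert

variable {m : Side → ℕ}

/-- The cutvertex of `H` common to `J` and `L`. -/
abbrev b : HVert m := inner .b

/-- The cutvertex of `H` common to `L` and `R`. -/
abbrev c : HVert m := inner .c

/-- The vertices of the block `J` other than `a` and `b`. -/
abbrev j (s : Side) (k : X) : HVert m := inner (.j s k)

/-- The vertices of the block `L` other than `c` and `b`. -/
abbrev l (s : Side) (k : X) : HVert m := inner (.l s k)

/-- The vertices of the cycle `R` other than `c` and `d`. -/
abbrev r (s : Side) (k : Fin (m s)) : HVert m := inner (.r s k)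

end HVert

/-- The edges of one half of a block: the 5-cycles `e x₁ x₂ x₃ x₄` and `x₃ x₅ x₆ x₇ x₈`, which
share the vertex `x₃`, and the three edges from `x₄`, `x₇`, `x₈` to `b`. -/
def halfBlock {V : Type*} (e b : V) (x : X → V) : Set (Sym2 V) :=
  {s(e, x .x1), s(x .x1, x .x2), s(x .x2, x .x3), s(x .x3, x .x4), s(x .x4, e),
   s(x .x3, x .x5), s(x .x5, x .x6), s(x .x6, x .x7), s(x .x7, x .x8), s(x .x8, x .x3),
   s(x .x4, b), s(x .x7, b), s(x .x8, b)}

/-- The successive vertices `c, r s 0, …, r s (m s - 1), d` of the path on side `s` of `R`. -/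
def rPath (m : Side → ℕ) (s : Side) : ℕ → HVert m
  | 0 => .c
  | k + 1 => if h : k < m s then .r s ⟨k, h⟩ else .d

/-- The gadget `H`: the block `J` (two half blocks with ends `a` and `b`), the block `L` (a mirror
image of `J`, with `c` in the role of `a`), and the cycle `R` through `c` and `d`. -/
def H (m : Side → ℕ) : SimpleGraph (HVert m) :=
  SimpleGraph.fromEdgeSet
    ((⋃ s, halfBlock .a .b (.j s)) ∪ (⋃ s, halfBlock .c .b (.l s)) ∪
      {e | ∃ s k, k ≤ m s ∧ e = s(rPath m s k, rPath m s (k + 1))})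

/-- The path from `a` to `d` on side `s` of the boundary walk of `H`, as a list of vertices. -/
def boundaryPath (m : Side → ℕ) (s : Side) : List (HVert m) :=
  [.a, .j s .x1, .j s .x2, .j s .x3, .j s .x5, .j s .x6, .j s .x7,
    .b, .l s .x7, .l s .x6, .l s .x5, .l s .x3, .l s .x2, .l s .x1, .c] ++
  List.ofFn (fun k : Fin (m s) => HVert.r s k) ++ [.d]

/-- Vertices of `G_n`. The vertices `cut 0, …, cut n` are the ends of the gadgets, after the end `d`
of each gadget has been identified with the end `a` of the next one. -/
inductive GVert (m : Side → ℕ) (n : ℕ)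
  | x
  | y
  | cut (i : Fin (n + 1))
  | inner (i : Fin n) (v : Inner m)

/-- The vertex of `G_n` that a vertex of the `i`-th copy of `H` becomes. -/
def copy {m : Side → ℕ} {n : ℕ} (i : Fin n) : HVert m → GVert m n
  | .a => .cut i.castSucc
  | .d => .cut i.succ
  | .inner v => .inner i v

/-- The vertex `x` is joined to the upper boundary paths, the vertex `y` to the lower ones. -/
def apex {m : Side → ℕ} {n : ℕ} : Side → GVert m n
  | .upper => .x
  | .lower => .y

/-- The graph `G_n`. -/
def G (m : Side → ℕ) (n : ℕ) : SimpleGraph (GVert m n) :=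
  (⨆ i : Fin n, (H m).map (copy i)) ⊔
    SimpleGraph.fromEdgeSet {e | ∃ s i, ∃ v ∈ boundaryPath m s, e = s(apex s, copy i v)}

open Classical in
/-- A graph is prism-hamiltonian if its Cartesian product with `K₂` has a Hamilton cycle. -/
def IsPrismHamiltonian {V : Type*} (G : SimpleGraph V) : Prop :=
  ∃ (v : V × Fin 2) (w : (G.boxProd (⊤ : SimpleGraph (Fin 2))).Walk v v), w.IsHamiltonianCycle

end PrismCounterexample

/-! Of a Hamilton cycle `C` of the prism only two properties are used: every degree is 2, and no
proper nonempty vertex set is closed under adjacency in `C`. The four copies of `x` and `y` have at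
most eight neighbours in `C`, so among 13 disjoint pairs of consecutive gadgets one pair is
untouched: `C` joins none of its inner vertices to an apex (`exists_untouched_pair`). It remains to
refute two consecutive untouched gadgets.

The engine is parity. If `C` enters a path of degree-two vertices by a single edge, it switches
layers at every inner vertex (`IsSegment.cases`). Hence an odd cycle through `c` and `d` cannot be
attached to the rest at `c` by exactly one edge per layer (`false_of_odd_cycle`). Applied to the two
5-cycles, this forces every half block to use an edge to `b` (`bDeg_pos`). The two copies of `b`
have total degree 4 and serve four half blocks, so each half block gets exactly one edge, and by a
handshake count it sends an odd number of edges to its other end (`deg_facts`).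

Consequently a set of vertices left only through an untouched gadget gets no further than its vertex
`c`: either the `c` copies close the set up, or the odd cycle `R` is met in the forbidden way
(`false_of_entrance`). For two consecutive gadgets, the cycle `R` of the first has so few edges of
`C` at `c` and `d` that in every case such a set appears in front of the second
(`false_of_consecutive`). -/

namespace PrismCounterexample

/-! ### Degree counts and closed sets in a spanning cycle -/

open Classical in
/-- The indicator of adjacency, as a natural number. -/
noncomputable def ind {W : Type*} (C : SimpleGraph W) (v w : W) : ℕ := if C.Adj v w then 1 else 0

section ind

variable {W : Type*} {C : SimpleGraph W} {v w : W}

theorem ind_comm (C : SimpleGraph W) (v w : W) : ind C v w = ind C w v := by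
  unfold ind
  by_cases h : C.Adj v w
  · rw [if_pos h, if_pos h.symm]
  · rw [if_neg h, if_neg (fun h' => h h'.symm)]

theorem ind_le_one (C : SimpleGraph W) (v w : W) : ind C v w ≤ 1 := by
  unfold ind; split <;> simp

theorem ind_eq_one (h : C.Adj v w) : ind C v w = 1 := by simp [ind, h]

theorem not_adj_of_ind (h : ind C v w = 0) : ¬ C.Adj v w := by
  intro h'; simp [ind, h'] at h

theorem sum_ind_eq_ncard (v : W) {l : List W} (hl : l.Nodup) :
    (l.map (ind C v)).sum = {w | w ∈ l ∧ C.Adj v w}.ncard := by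
  induction l with
  | nil => simp
  | cons a l ih =>
    rw [List.nodup_cons] at hl
    have hfin : {w | w ∈ l ∧ C.Adj v w}.Finite := l.finite_toSet.subset fun w hw => hw.1
    rw [List.map_cons, List.sum_cons, ih hl.2]
    by_cases h : C.Adj v a
    · have : {w | w ∈ a :: l ∧ C.Adj v w} = insert a {w | w ∈ l ∧ C.Adj v w} := by
        ext w
        simp only [List.mem_cons, Set.mem_ofPred_eq, Set.mem_insert_iff]
        constructor
        · rintro ⟨rfl | h1, h2⟩ <;> tauto
        · rintro (rfl | h1) <;> tauto
      rw [this, Set.ncard_insert_of_notMem (fun h' => hl.1 h'.1) hfin, ind_eq_one h, add_comm]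
    · have : {w | w ∈ a :: l ∧ C.Adj v w} = {w | w ∈ l ∧ C.Adj v w} := by
        ext w
        simp only [List.mem_cons, Set.mem_ofPred_eq]
        constructor
        · rintro ⟨rfl | h1, h2⟩ <;> tauto
        · tauto
      rw [this]; simp [ind, h]

end ind

/-- A graph that looks like a spanning cycle: all degrees are two, and every proper nonempty set
of vertices is left by an edge. -/
structure IsSpanningCycle {W : Type*} (C : SimpleGraph W) : Prop where
  ncard_eq : ∀ v, (C.neighborSet v).ncard = 2
  exists_exit : ∀ S : Set W, S.Nonempty → Sᶜ.Nonempty → ∃ u ∈ S, ∃ v ∉ S, C.Adj u v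

namespace IsSpanningCycle

variable {W : Type*} {C : SimpleGraph W} (hC : IsSpanningCycle C)
include hC

theorem finite_neighborSet (v : W) : (C.neighborSet v).Finite :=
  Set.finite_of_ncard_ne_zero (by simp [hC.ncard_eq v])

theorem sum_le (v : W) (l : List W) (hl : l.Nodup) : (l.map (ind C v)).sum ≤ 2 := by
  rw [sum_ind_eq_ncard v hl, ← hC.ncard_eq v]
  exact Set.ncard_le_ncard (fun w hw => hw.2) (hC.finite_neighborSet v)

theorem sum_eq (v : W) (l : List W) (hl : l.Nodup) (h : ∀ w, C.Adj v w → w ∈ l) :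
    (l.map (ind C v)).sum = 2 := by
  rw [sum_ind_eq_ncard v hl, ← hC.ncard_eq v]
  congr 1
  ext w
  exact ⟨fun hw => hw.2, fun hw => ⟨h w hw, hw⟩⟩

theorem mem_of_sum {v w : W} (l : List W) (hl : l.Nodup) (h : 2 ≤ (l.map (ind C v)).sum)
    (hw : C.Adj v w) : w ∈ l := by
  by_contra hwl
  have := hC.sum_le v (w :: l) (List.nodup_cons.2 ⟨hwl, hl⟩)
  rw [List.map_cons, List.sum_cons, ind_eq_one hw] at this
  omega

/-- The only place where connectedness of `C` enters; every contradiction below that is not a degree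
count is a closed set missing some `z`. -/
theorem false_of_closed (S : Set W) {u z : W} (hu : u ∈ S) (hz : z ∉ S)
    (h : ∀ v ∈ S, ∀ w, C.Adj v w → w ∈ S) : False := by
  obtain ⟨v, hv, w, hw, hvw⟩ := hC.exists_exit S ⟨u, hu⟩ ⟨z, hz⟩
  exact hw (h v hv w hvw)

end IsSpanningCycle

/-! ### Paths of degree-two vertices in the prism -/

section Segment

variable {V : Type*} {C : SimpleGraph (V × Fin 2)} {u w : ℕ → V} {k p q : ℕ}

/-- The inner vertices `u 1, …, u k` of the sequence have, in the prism, no neighbours in `C`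
except along the sequence and along the rungs of the prism. -/
structure IsSegment (C : SimpleGraph (V × Fin 2)) (u : ℕ → V) (k : ℕ) : Prop where
  ne : ∀ j < k, u j ≠ u (j + 2)
  adj : ∀ j < k, ∀ ε v, C.Adj (u (j + 1), ε) v →
    v = (u (j + 1), ε + 1) ∨ v = (u j, ε) ∨ v = (u (j + 2), ε)

/-- The indicator of the `j`-th edge of the sequence in the layer `ε`. -/
noncomputable def edgeInd (C : SimpleGraph (V × Fin 2)) (u : ℕ → V) (j : ℕ) (ε : Fin 2) : ℕ :=
  ind C (u j, ε) (u (j + 1), ε)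

/-- The inner vertices of the sequence. -/
def segSet (u : ℕ → V) (k : ℕ) : Set (V × Fin 2) := {v | ∃ j < k, v.1 = u (j + 1)}

theorem edgeInd_le_one (j : ℕ) (ε : Fin 2) : edgeInd C u j ε ≤ 1 := ind_le_one _ _ _

theorem IsSegment.mono (hu : IsSegment C u k) (h : p ≤ k) : IsSegment C u p :=
  ⟨fun j hj => hu.ne j (by omega), fun j hj => hu.adj j (by omega)⟩

theorem IsSegment.degree (hC : IsSpanningCycle C) (hu : IsSegment C u k) {j : ℕ} (hj : j < k)
    (ε : Fin 2) :
    ind C (u (j + 1), 0) (u (j + 1), 1) + edgeInd C u j ε + edgeInd C u (j + 1) ε = 2 := by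
  have h := hC.sum_eq (u (j + 1), ε) [(u (j + 1), ε + 1), (u j, ε), (u (j + 2), ε)]
    (by simp [hu.ne j hj]) (by simpa using hu.adj j hj ε)
  simp only [List.map_cons, List.map_nil, List.sum_cons, List.sum_nil] at h
  rw [edgeInd, edgeInd, ind_comm C (u j, ε)]
  have h' : ind C (u (j + 1), 0) (u (j + 1), 1) = ind C (u (j + 1), ε) (u (j + 1), ε + 1) := by
    fin_cases ε
    · rfl
    · exact ind_comm _ _ _
  rw [h', show u (j + 1 + 1) = u (j + 2) from rfl]
  omega

theorem IsSegment.exit (hu : IsSegment C u k) {v v' : V × Fin 2} (hv : v ∈ segSet u k)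
    (h : C.Adj v v') :
    v' ∈ segSet u k ∨ (v' = (u 0, v'.2) ∧ edgeInd C u 0 v'.2 = 1 ∧ v = (u 1, v'.2)) ∨
      (v' = (u (k + 1), v'.2) ∧ edgeInd C u k v'.2 = 1 ∧ v = (u k, v'.2)) := by
  obtain ⟨j, hj, hv⟩ := hv
  obtain ⟨v, ε⟩ := v
  obtain rfl : v = u (j + 1) := hv
  rcases hu.adj j hj ε v' h with rfl | rfl | rfl
  · exact .inl ⟨j, hj, rfl⟩
  · rcases j with _ | j
    · exact .inr (.inl ⟨rfl, ind_eq_one h.symm, rfl⟩)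
    · exact .inl ⟨j, by omega, rfl⟩
  · by_cases hjk : j + 1 < k
    · exact .inl ⟨j + 1, hjk, rfl⟩
    · obtain rfl : j + 1 = k := by omega
      exact .inr (.inr ⟨rfl, ind_eq_one h, rfl⟩)

/-- Both copies of an inner vertex share their rung. So if the layers agree on one edge of the path,
they agree on the next; if exactly one layer is used, the rung is forced and the other layer is used
next. The parity of `k` thus fixes the layer of exit. -/
theorem IsSegment.cases (hC : IsSpanningCycle C) (hu : IsSegment C u k) (hk : 1 ≤ k)
    {z : V × Fin 2} (hz : z ∉ segSet u k) :
    (edgeInd C u 0 0 = 1 ∧ edgeInd C u 0 1 = 1 ∧ edgeInd C u k 0 = edgeInd C u k 1) ∨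
    (edgeInd C u 0 0 = 0 ∧ edgeInd C u 0 1 = 0 ∧ edgeInd C u k 0 = 1 ∧ edgeInd C u k 1 = 1) ∨
    (edgeInd C u 0 0 + edgeInd C u 0 1 = 1 ∧ edgeInd C u k 0 + edgeInd C u k 1 = 1 ∧
      (k % 2 = 0 → edgeInd C u k 0 = edgeInd C u 0 0) ∧
      (k % 2 = 1 → edgeInd C u k 0 = edgeInd C u 0 1)) := by
  have e0 := edgeInd_le_one (C := C) (u := u) 0 0
  have e1 := edgeInd_le_one (C := C) (u := u) 0 1
  by_cases h11 : edgeInd C u 0 0 = 1 ∧ edgeInd C u 0 1 = 1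
  · refine .inl ⟨h11.1, h11.2, ?_⟩
    have : ∀ j ≤ k, edgeInd C u j 0 = edgeInd C u j 1 := by
      intro j
      induction j with
      | zero => intro _; omega
      | succ j ih =>
        intro hj
        have d0 := hu.degree hC (j := j) (by omega) 0
        have d1 := hu.degree hC (j := j) (by omega) 1
        have := ih (by omega)
        omega
    exact this k le_rfl
  by_cases h00 : edgeInd C u 0 0 = 0 ∧ edgeInd C u 0 1 = 0
  · refine .inr (.inl ⟨h00.1, h00.2, ?_⟩)
    have : ∀ j < k, edgeInd C u (j + 1) 0 = 1 ∧ edgeInd C u (j + 1) 1 = 1 := by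
      intro j
      induction j with
      | zero =>
        intro hj
        have d0 := hu.degree hC (j := 0) (by omega) 0
        have d1 := hu.degree hC (j := 0) (by omega) 1
        have := ind_le_one C (u (0 + 1), 0) (u (0 + 1), 1)
        have := edgeInd_le_one (C := C) (u := u) (0 + 1) 0
        have := edgeInd_le_one (C := C) (u := u) (0 + 1) 1
        omega
      | succ j ih =>
        intro hj
        have d0 := hu.degree hC (j := j + 1) (by omega) 0
        have d1 := hu.degree hC (j := j + 1) (by omega) 1
        have := ih (by omega)
        have := edgeInd_le_one (C := C) (u := u) (j + 1 + 1) 0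
        by_contra hne
        -- With edge `j + 2` unused in both layers, as edge 0 is, the first `j + 2` inner vertices
        -- would form a closed set.
        have hu' := hu.mono (p := j + 2) (by omega)
        have hzero : ∀ ε, edgeInd C u (j + 2) ε = 0 := by
          intro ε
          have a0 : edgeInd C u (j + 1 + 1) 0 = 0 := by omega
          have a1 : edgeInd C u (j + 1 + 1) 1 = 0 := by omega
          fin_cases ε
          · exact a0
          · exact a1
        have hzero' : ∀ ε, edgeInd C u 0 ε = 0 := by
          intro ε
          fin_cases ε
          · exact h00.1
          · exact h00.2
        refine hC.false_of_closed (segSet u (j + 2)) (u := (u 1, 0)) ⟨0, by omega, rfl⟩ (z := z) ?_ ?_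
        · rintro ⟨i, hi, h⟩
          exact hz ⟨i, by omega, h⟩
        · intro v hv w h
          rcases hu'.exit hv h with h | h | h
          · exact h
          · have := hzero' w.2; omega
          · have := hzero w.2; omega
    obtain ⟨k, rfl⟩ : ∃ k', k = k' + 1 := ⟨k - 1, by omega⟩
    exact this k (by omega)
  · refine .inr (.inr ?_)
    have : ∀ j ≤ k, edgeInd C u j 0 + edgeInd C u j 1 = 1 ∧
        (j % 2 = 0 → edgeInd C u j 0 = edgeInd C u 0 0) ∧
        (j % 2 = 1 → edgeInd C u j 0 = edgeInd C u 0 1) := by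
      intro j
      induction j with
      | zero => intro _; omega
      | succ j ih =>
        intro hj
        have d0 := hu.degree hC (j := j) (by omega) 0
        have d1 := hu.degree hC (j := j) (by omega) 1
        have := ind_le_one C (u (j + 1), 0) (u (j + 1), 1)
        have := edgeInd_le_one (C := C) (u := u) (j + 1) 0
        have := edgeInd_le_one (C := C) (u := u) (j + 1) 1
        have := ih (by omega)
        omega
    have := this k le_rfl
    refine ⟨by omega, this⟩

/-- A segment both of whose ends are the same vertex. -/
theorem IsSegment.false_of_loop (hC : IsSpanningCycle C) (hu : IsSegment C u k) (hk : 1 ≤ k)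
    (hend : u (k + 1) = u 0) (hne : u 1 ≠ u k) {z : V × Fin 2} (hz : z ∉ segSet u k)
    (hz0 : z.1 ≠ u 0) (h : ∀ ε, edgeInd C u 0 ε = edgeInd C u k ε) : False := by
  -- A copy of the common end that is reached at all is reached from both sides, so its degree is
  -- exhausted inside the loop.
  refine hC.false_of_closed (segSet u k ∪ {v | v.1 = u 0 ∧ edgeInd C u 0 v.2 = 1})
    (u := (u 1, 0)) (z := z) (.inl ⟨0, by omega, rfl⟩) ?_ ?_
  · rintro (h | h)
    · exact hz h
    · exact hz0 h.1
  · rintro ⟨v, ε⟩ (hv | ⟨rfl, hv⟩) w hw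
    · rcases hu.exit hv hw with h' | h' | h'
      · exact .inl h'
      · exact .inr ⟨by rw [h'.1], h'.2.1⟩
      · exact .inr ⟨by rw [h'.1, hend], by rw [h, h'.2.1]⟩
    · have hv' := hv
      simp only at hv
      rw [h, edgeInd, hend, ind_comm] at hv
      simp only [edgeInd] at hv'
      have := hC.mem_of_sum (v := (u 0, ε)) [(u 1, ε), (u k, ε)] (by simp [hne])
        (by simp only [List.map_cons, List.map_nil, List.sum_cons, List.sum_nil]; simp at hv'; omega) hw
      simp only [List.mem_cons, List.not_mem_nil, or_false] at this
      rcases this with rfl | rfl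
      · exact .inl ⟨0, by omega, rfl⟩
      · exact .inl ⟨k - 1, by omega, by simp [Nat.sub_add_cancel hk]⟩

/-- An odd cycle through `c` and `d` cannot be entered at `c` by one edge in each layer. -/
theorem false_of_odd_cycle (hC : IsSpanningCycle C) (hu : IsSegment C u p) (hw : IsSegment C w q)
    (hp : 1 ≤ p) (hq : 1 ≤ q) (hodd : (p + q) % 2 = 1) {c d : V} (hu0 : u 0 = c) (hw0 : w 0 = c)
    (hud : u (p + 1) = d) (hwd : w (q + 1) = d) (hne : u p ≠ w q) (T : Set (V × Fin 2))
    (hT : ∀ v ∈ T, ∀ v', C.Adj v v' → v' ∈ T ∨ v'.1 = c)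
    (hc : ∀ ε v, C.Adj (c, ε) v → v ∈ T ∨ v.1 = c ∨ v = (u 1, ε) ∨ v = (w 1, ε))
    (hsum : ∀ ε, ind C (c, ε) (c, ε + 1) + ind C (c, ε) (u 1, ε) + ind C (c, ε) (w 1, ε) = 1)
    {z : V × Fin 2} (hzT : z ∉ T) (hzc : z.1 ≠ c) (hzd : z.1 ≠ d) (hzu : z ∉ segSet u p)
    (hzw : z ∉ segSet w q) : False := by
  -- If both paths arrive at `d` in the same layers, each copy of `d` that is reached is saturated,
  -- and everything so far is closed.
  have closed1 : ¬ ∀ ε, edgeInd C u p ε = edgeInd C w q ε := by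
    intro h
    refine hC.false_of_closed (T ∪ {v | v.1 = c} ∪ segSet u p ∪ segSet w q ∪
      {v | v.1 = d ∧ edgeInd C u p v.2 = 1}) (u := (c, 0)) (z := z) (by simp) ?_ ?_
    · rintro ((((h | h) | h) | h) | h)
      exacts [hzT h, hzc h, hzu h, hzw h, hzd h.1]
    · rintro ⟨v, ε⟩ ((((hv | hv) | hv) | hv) | hv) v' hv'
      · rcases hT _ hv _ hv' with h | h
        · exact .inl (.inl (.inl (.inl h)))
        · exact .inl (.inl (.inl (.inr h)))
      · obtain rfl : v = c := hv
        rcases hc _ _ hv' with h | h | rfl | rfl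
        · exact .inl (.inl (.inl (.inl h)))
        · exact .inl (.inl (.inl (.inr h)))
        · exact .inl (.inl (.inr ⟨0, by omega, rfl⟩))
        · exact .inl (.inr ⟨0, by omega, rfl⟩)
      · rcases hu.exit hv hv' with h' | h' | h'
        · exact .inl (.inl (.inr h'))
        · exact .inl (.inl (.inl (.inr (by rw [h'.1, hu0]; rfl))))
        · exact .inr ⟨by rw [h'.1, hud], h'.2.1⟩
      · rcases hw.exit hv hv' with h' | h' | h'
        · exact .inl (.inr h')
        · exact .inl (.inl (.inl (.inr (by rw [h'.1, hw0]; rfl))))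
        · exact .inr ⟨by rw [h'.1, hwd], by rw [h, h'.2.1]⟩
      · obtain ⟨rfl, hv⟩ := hv
        have hv2 := hv
        rw [h] at hv2
        simp only [edgeInd, hud] at hv
        simp only [edgeInd, hwd] at hv2
        rw [ind_comm] at hv hv2
        have := hC.mem_of_sum (v := (v, ε)) [(u p, ε), (w q, ε)] (by simp [hne])
          (by simp only [List.map_cons, List.map_nil, List.sum_cons, List.sum_nil]; omega) hv'
        simp only [List.mem_cons, List.not_mem_nil, or_false] at this
        rcases this with rfl | rfl
        · exact .inl (.inl (.inr ⟨p - 1, by omega, by simp [Nat.sub_add_cancel hp]⟩))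
        · exact .inl (.inr ⟨q - 1, by omega, by simp [Nat.sub_add_cancel hq]⟩)
  -- Stated for fresh `u`, `w` because it is used with the two paths in either order.
  have closed2 : ∀ {u w : ℕ → V} {p : ℕ}, IsSegment C u p → 1 ≤ p → u 0 = c → w 0 = c →
      (∀ ε v, C.Adj (c, ε) v → v ∈ T ∨ v.1 = c ∨ v = (u 1, ε) ∨ v = (w 1, ε)) →
      z ∉ segSet u p → (∀ ε, edgeInd C u p ε = 0) → (∀ ε, edgeInd C w 0 ε = 0) → False := by
    intro u w p hu hp hu0 hw0 hc hzu h1 h2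
    refine hC.false_of_closed (T ∪ {v | v.1 = c} ∪ segSet u p) (u := (c, 0)) (z := z)
      (by simp) ?_ ?_
    · rintro ((h | h) | h)
      exacts [hzT h, hzc h, hzu h]
    · rintro ⟨v, ε⟩ ((hv | hv) | hv) v' hv'
      · rcases hT _ hv _ hv' with h | h
        · exact .inl (.inl h)
        · exact .inl (.inr h)
      · obtain rfl : v = c := hv
        rcases hc _ _ hv' with h | h | rfl | rfl
        · exact .inl (.inl h)
        · exact .inl (.inr h)
        · exact .inr ⟨0, by omega, rfl⟩
        · have := h2 ε
          rw [edgeInd, hw0] at this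
          exact (not_adj_of_ind this hv').elim
      · rcases hu.exit hv hv' with h' | h' | h'
        · exact .inr h'
        · exact .inl (.inr (by rw [h'.1, hu0]; rfl))
        · have := h1 v'.2
          omega
  have s0 := hsum 0
  have s1 := hsum 1
  have vert : ind C (c, 0) (c, 0 + 1) = ind C (c, 1) (c, 1 + 1) := ind_comm _ _ _
  have eu : ∀ ε, ind C (c, ε) (u 1, ε) = edgeInd C u 0 ε := by intro ε; rw [edgeInd, hu0]
  have ew : ∀ ε, ind C (c, ε) (w 1, ε) = edgeInd C w 0 ε := by intro ε; rw [edgeInd, hw0]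
  rw [eu, ew, vert] at s0
  rw [eu, ew] at s1
  have b1 := edgeInd_le_one (C := C) (u := u) p 0
  have b2 := edgeInd_le_one (C := C) (u := w) q 0
  -- When both paths start with a single edge, `hsum` puts these edges in opposite layers; as `p +
  -- q` is odd, the paths reach `d` in the same layer.
  rcases hu.cases hC hp hzu with h | h | h <;> rcases hw.cases hC hq hzw with h' | h' | h'
  · omega
  · by_cases hz : edgeInd C u p 0 = 0
    · exact closed2 hu hp hu0 hw0 hc hzu (Fin.forall_fin_two.2 ⟨by omega, by omega⟩) (Fin.forall_fin_two.2 ⟨by omega, by omega⟩)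
    · exact closed1 (Fin.forall_fin_two.2 ⟨by omega, by omega⟩)
  · omega
  · by_cases hz : edgeInd C w q 0 = 0
    · exact closed2 hw hq hw0 hu0 (fun ε v hv => by have := hc ε v hv; tauto) hzw
        (Fin.forall_fin_two.2 ⟨by omega, by omega⟩) (Fin.forall_fin_two.2 ⟨by omega, by omega⟩)
    · exact closed1 (Fin.forall_fin_two.2 ⟨by omega, by omega⟩)
  · exact closed1 (Fin.forall_fin_two.2 ⟨by omega, by omega⟩)
  · omega
  · omega
  · omega
  · exact closed1 (Fin.forall_fin_two.2 ⟨by omega, by omega⟩)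

end Segment

/-! ### Half blocks -/

section HalfBlock

variable {V : Type*} {C : SimpleGraph (V × Fin 2)} {e b : V} {x : X → V}

/-- The neighbours in a half block of its inner vertices. -/
def halfBlockNeighbors (e b : V) (x : X → V) : X → List V
  | .x1 => [e, x .x2]
  | .x2 => [x .x1, x .x3]
  | .x3 => [x .x2, x .x4, x .x5, x .x8]
  | .x4 => [x .x3, e, b]
  | .x5 => [x .x3, x .x6]
  | .x6 => [x .x5, x .x7]
  | .x7 => [x .x6, x .x8, b]
  | .x8 => [x .x7, x .x3, b]

/-- A half block whose inner vertices have no neighbours in `C` outside the prism of the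
half block. -/
structure IsHalfBlock (C : SimpleGraph (V × Fin 2)) (e b : V) (x : X → V) : Prop where
  inj : Function.Injective x
  ne_e : ∀ k, x k ≠ e
  ne_b : ∀ k, x k ≠ b
  e_ne_b : e ≠ b
  adj : ∀ k ε v, C.Adj (x k, ε) v →
    v = (x k, ε + 1) ∨ (v.1 ∈ halfBlockNeighbors e b x k ∧ v.2 = ε)

/-- The number of edges of `C` from the copy of the end `e` in layer `ε` to a half block. -/
noncomputable def eDeg (C : SimpleGraph (V × Fin 2)) (e : V) (x : X → V) (ε : Fin 2) : ℕ :=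
  ind C (e, ε) (x .x1, ε) + ind C (e, ε) (x .x4, ε)

/-- The number of edges of `C` from the copy of the end `b` in layer `ε` to a half block. -/
noncomputable def bDeg (C : SimpleGraph (V × Fin 2)) (b : V) (x : X → V) (ε : Fin 2) : ℕ :=
  ind C (b, ε) (x .x4, ε) + ind C (b, ε) (x .x7, ε) + ind C (b, ε) (x .x8, ε)

namespace IsHalfBlock

variable (hx : IsHalfBlock C e b x)
include hx

theorem nodup_neighbors (k : X) : (halfBlockNeighbors e b x k).Nodup := by
  have h1 := hx.ne_e
  have h2 := hx.ne_b
  have h3 := hx.e_ne_b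
  have h1' := fun k => (hx.ne_e k).symm
  cases k <;> simp [halfBlockNeighbors, hx.inj.eq_iff, h1, h2, h3, h1']

theorem degree (hC : IsSpanningCycle C) (k : X) (ε : Fin 2) :
    ind C (x k, 0) (x k, 1) +
      ((halfBlockNeighbors e b x k).map fun v => ind C (x k, ε) (v, ε)).sum = 2 := by
  have h := hC.sum_eq (x k, ε) ((x k, ε + 1) :: (halfBlockNeighbors e b x k).map fun v => (v, ε))
    (by
      rw [List.nodup_cons]
      refine ⟨?_, (hx.nodup_neighbors k).map fun v w h => (Prod.ext_iff.1 h).1⟩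
      simp)
    (by
      intro v hv
      rcases hx.adj k ε v hv with rfl | h
      · simp
      · refine List.mem_cons_of_mem _ (List.mem_map.2 ⟨v.1, h.1, ?_⟩)
        rw [← h.2])
  rw [List.map_cons, List.sum_cons, List.map_map] at h
  have h' : ind C (x k, 0) (x k, 1) = ind C (x k, ε) (x k, ε + 1) := by
    fin_cases ε
    · rfl
    · exact ind_comm _ _ _
  rw [h']
  exact h

/-- Handshake in each layer: the eight inner degrees sum to 16, so the edges leaving the half block
have the parity of the number of rungs, which is the same for both layers. -/
theorem even_deg (hC : IsSpanningCycle C) :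
    (eDeg C e x 0 + eDeg C e x 1 + bDeg C b x 0 + bDeg C b x 1) % 2 = 0 := by
  have c := fun k k' ε => ind_comm C (x k, ε) (x k', ε)
  have key : ∀ ε, (2 * 8 : ℤ) = ind C (x .x1, 0) (x .x1, 1) + ind C (x .x2, 0) (x .x2, 1) +
      ind C (x .x3, 0) (x .x3, 1) + ind C (x .x4, 0) (x .x4, 1) + ind C (x .x5, 0) (x .x5, 1) +
      ind C (x .x6, 0) (x .x6, 1) + ind C (x .x7, 0) (x .x7, 1) + ind C (x .x8, 0) (x .x8, 1) +
      eDeg C e x ε + bDeg C b x ε + 2 * (ind C (x .x1, ε) (x .x2, ε) +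
      ind C (x .x2, ε) (x .x3, ε) + ind C (x .x3, ε) (x .x4, ε) + ind C (x .x3, ε) (x .x5, ε) +
      ind C (x .x5, ε) (x .x6, ε) + ind C (x .x6, ε) (x .x7, ε) + ind C (x .x7, ε) (x .x8, ε) +
      ind C (x .x3, ε) (x .x8, ε)) := by
    intro ε
    have d1 := hx.degree hC .x1 ε
    have d2 := hx.degree hC .x2 ε
    have d3 := hx.degree hC .x3 ε
    have d4 := hx.degree hC .x4 ε
    have d5 := hx.degree hC .x5 ε
    have d6 := hx.degree hC .x6 ε
    have d7 := hx.degree hC .x7 ε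
    have d8 := hx.degree hC .x8 ε
    simp only [halfBlockNeighbors, List.map_cons, List.map_nil, List.sum_cons, List.sum_nil]
      at d1 d2 d3 d4 d5 d6 d7 d8
    rw [c .x2 .x1] at d2
    rw [c .x3 .x2] at d3
    rw [c .x4 .x3] at d4
    rw [c .x5 .x3] at d5
    rw [c .x6 .x5] at d6
    rw [c .x7 .x6] at d7
    rw [c .x8 .x7, c .x8 .x3] at d8
    rw [eDeg, bDeg, ind_comm C (e, ε) (x .x1, ε), ind_comm C (e, ε), ind_comm C (b, ε),
      ind_comm C (b, ε), ind_comm C (b, ε)]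
    push_cast
    zify at d1 d2 d3 d4 d5 d6 d7 d8
    linear_combination -d1 - d2 - d3 - d4 - d5 - d6 - d7 - d8
  have k0 := key 0
  have k1 := key 1
  omega

theorem exit {k : X} {ε : Fin 2} {v : V × Fin 2} (h : C.Adj (x k, ε) v) :
    (∃ k', v.1 = x k') ∨ v.1 = b ∨ (v.1 = e ∧ 1 ≤ eDeg C e x v.2) := by
  obtain ⟨v, ε'⟩ := v
  rcases hx.adj k ε _ h with h' | ⟨h', rfl⟩
  · exact .inl ⟨k, congrArg Prod.fst h'⟩
  · cases k <;> simp only [halfBlockNeighbors, List.mem_cons, List.not_mem_nil, or_false] at h'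
    · rcases h' with rfl | rfl
      · refine .inr (.inr ⟨rfl, ?_⟩)
        rw [eDeg, ind_eq_one h.symm]
        omega
      · exact .inl ⟨_, rfl⟩
    · rcases h' with rfl | rfl <;> exact .inl ⟨_, rfl⟩
    · rcases h' with rfl | rfl | rfl | rfl <;> exact .inl ⟨_, rfl⟩
    · rcases h' with rfl | rfl | rfl
      · exact .inl ⟨_, rfl⟩
      · refine .inr (.inr ⟨rfl, ?_⟩)
        rw [eDeg, ind_eq_one h.symm]
        omega
      · exact .inr (.inl rfl)
    · rcases h' with rfl | rfl <;> exact .inl ⟨_, rfl⟩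
    · rcases h' with rfl | rfl <;> exact .inl ⟨_, rfl⟩
    · rcases h' with rfl | rfl | rfl <;> first | exact .inl ⟨_, rfl⟩ | exact .inr (.inl rfl)
    · rcases h' with rfl | rfl | rfl <;> first | exact .inl ⟨_, rfl⟩ | exact .inr (.inl rfl)

/-- Without edges to `b` the half block acts as two 5-cycles sharing `x₃`. The one away from `e`
uses exactly one edge at each copy of `x₃`, so the other is an odd cycle attached at `x₃` in the
forbidden way. -/
theorem bDeg_pos (hC : IsSpanningCycle C) : 1 ≤ bDeg C b x 0 + bDeg C b x 1 := by
  by_contra hb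
  have hb' : ∀ ε, bDeg C b x ε = 0 := Fin.forall_fin_two.2 ⟨by omega, by omega⟩
  have n4 : ∀ ε, ¬ C.Adj (x .x4, ε) (b, ε) := fun ε h => by
    have := hb' ε
    rw [bDeg, ind_eq_one h.symm] at this
    omega
  have n7 : ∀ ε, ¬ C.Adj (x .x7, ε) (b, ε) := fun ε h => by
    have := hb' ε
    rw [bDeg, ind_eq_one h.symm] at this
    omega
  have n8 : ∀ ε, ¬ C.Adj (x .x8, ε) (b, ε) := fun ε h => by
    have := hb' ε
    rw [bDeg, ind_eq_one h.symm] at this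
    omega
  have adj : ∀ k ε v, C.Adj (x k, ε) v →
      v = (x k, ε + 1) ∨ ∃ w ∈ halfBlockNeighbors e b x k, v = (w, ε) := by
    rintro k ε ⟨v, ε'⟩ hv
    rcases hx.adj k ε _ hv with h | ⟨h, rfl⟩
    · exact .inl h
    · exact .inr ⟨v, h, rfl⟩
  -- The loop at `x₃` (its default value makes `u 5 = u 0`), then the two paths from `x₃` to `e`,
  -- with 2 and 1 inner vertices.
  let u : ℕ → V := fun j => match j with
    | 0 => x .x3
    | 1 => x .x5
    | 2 => x .x6
    | 3 => x .x7
    | 4 => x .x8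
    | _ => x .x3
  let v : ℕ → V := fun j => match j with
    | 0 => x .x3
    | 1 => x .x2
    | 2 => x .x1
    | _ => e
  let w : ℕ → V := fun j => match j with
    | 0 => x .x3
    | 1 => x .x4
    | _ => e
  have hu : IsSegment C u 4 := by
    constructor
    · intro j hj
      interval_cases j <;> simp [u, hx.inj.eq_iff]
    · intro j hj ε y hy
      interval_cases j <;> rcases adj _ _ _ hy with h | ⟨w, hw, rfl⟩ <;> try exact .inl h
      all_goals
        simp only [halfBlockNeighbors, List.mem_cons, List.not_mem_nil, or_false] at hw
        right
      · rcases hw with rfl | rfl <;> simp [u]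
      · rcases hw with rfl | rfl <;> simp [u]
      · rcases hw with rfl | rfl | rfl
        · simp [u]
        · simp [u]
        · exact (n7 _ hy).elim
      · rcases hw with rfl | rfl | rfl
        · simp [u]
        · simp [u]
        · exact (n8 _ hy).elim
  have hv : IsSegment C v 2 := by
    constructor
    · intro j hj
      interval_cases j <;> simp [v, hx.inj.eq_iff, hx.ne_e]
    · intro j hj ε y hy
      interval_cases j <;> rcases adj _ _ _ hy with h | ⟨w, hw, rfl⟩ <;> try exact .inl h
      all_goals
        simp only [halfBlockNeighbors, List.mem_cons, List.not_mem_nil, or_false] at hw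
        right
        rcases hw with rfl | rfl <;> simp [v]
  have hw : IsSegment C w 1 := by
    constructor
    · intro j hj
      interval_cases j
      simp [w, hx.ne_e]
    · intro j hj ε y hy
      interval_cases j
      rcases adj _ _ _ hy with h | ⟨w, hw, rfl⟩
      · exact .inl h
      simp only [halfBlockNeighbors, List.mem_cons, List.not_mem_nil, or_false] at hw
      right
      rcases hw with rfl | rfl | rfl
      · simp [w]
      · simp [w]
      · exact (n4 _ hy).elim
  have zu : ((b, 0) : V × Fin 2) ∉ segSet u 4 := by
    rintro ⟨j, hj, h⟩
    interval_cases j <;> exact hx.ne_b _ h.symm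
  have zv : ((b, 0) : V × Fin 2) ∉ segSet v 2 := by
    rintro ⟨j, hj, h⟩
    interval_cases j <;> exact hx.ne_b _ h.symm
  have zw : ((b, 0) : V × Fin 2) ∉ segSet w 1 := by
    rintro ⟨j, hj, h⟩
    interval_cases j
    exact hx.ne_b _ h.symm
  have z3 : b ≠ x .x3 := (hx.ne_b _).symm
  have hloop := hu.false_of_loop hC (by norm_num) rfl (fun h => by cases hx.inj h) zu z3
  -- The loop has an even number of inner vertices, so a single entering edge would leave in its own
  -- layer, which `hloop` excludes.
  have h58 : ∀ ε, edgeInd C u 0 ε + edgeInd C u 4 ε = 1 := by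
    rcases hu.cases hC (by norm_num) zu with h | h | h
    · have := edgeInd_le_one (C := C) (u := u) 4 0
      by_cases h4 : edgeInd C u 4 0 = 1
      · exact (hloop (Fin.forall_fin_two.2 ⟨by omega, by omega⟩)).elim
      · exact Fin.forall_fin_two.2 ⟨by omega, by omega⟩
    · exact Fin.forall_fin_two.2 ⟨by omega, by omega⟩
    · have := h.2.2.1 rfl
      exact (hloop (Fin.forall_fin_two.2 ⟨by omega, by omega⟩)).elim
  refine false_of_odd_cycle hC hv hw (by norm_num) (by norm_num) (by norm_num) (c := x .x3) (d := e)
    rfl rfl rfl rfl (fun h => by cases hx.inj h) (segSet u 4) ?_ ?_ ?_ zu z3 hx.e_ne_b.symm zv zw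
  · intro y hy y' h
    rcases hu.exit hy h with h | h | h
    · exact .inl h
    · exact .inr (congrArg Prod.fst h.1)
    · exact .inr (congrArg Prod.fst h.1)
  · intro ε y hy
    rcases adj _ _ _ hy with rfl | ⟨w', hw', rfl⟩
    · exact .inr (.inl rfl)
    · simp only [halfBlockNeighbors, List.mem_cons, List.not_mem_nil, or_false] at hw'
      rcases hw' with rfl | rfl | rfl | rfl
      · exact .inr (.inr (.inl rfl))
      · exact .inr (.inr (.inr rfl))
      · exact .inl ⟨0, by norm_num, rfl⟩
      · exact .inl ⟨3, by norm_num, rfl⟩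
  · intro ε
    have h := hx.degree hC .x3 ε
    simp only [halfBlockNeighbors, List.map_cons, List.map_nil, List.sum_cons, List.sum_nil] at h
    have h' := h58 ε
    have e1 : edgeInd C u 0 ε = ind C (x .x3, ε) (x .x5, ε) := rfl
    have e2 : edgeInd C u 4 ε = ind C (x .x3, ε) (x .x8, ε) := ind_comm _ _ _
    have e3 : ind C (x .x3, ε) (x .x3, ε + 1) = ind C (x .x3, 0) (x .x3, 1) := by
      fin_cases ε
      · rfl
      · exact ind_comm _ _ _
    change _ + ind C (x .x3, ε) (x .x2, ε) + ind C (x .x3, ε) (x .x4, ε) = 1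
    omega

end IsHalfBlock

end HalfBlock

/-! ### Neighbourhoods in the gadget -/

section HNeighbors

variable {m : Side → ℕ}

theorem mem_neighbors_of_mem_halfBlock {V : Type*} {e b : V} {x : X → V}
    (hinj : Function.Injective x) (he : ∀ k, x k ≠ e) (hb : ∀ k, x k ≠ b) {k : X} {v : V}
    (h : s(x k, v) ∈ halfBlock e b x) : v ∈ halfBlockNeighbors e b x k := by
  simp only [halfBlock, Set.mem_insert_iff, Set.mem_singleton_iff, Sym2.eq_iff, hinj.eq_iff, he,
    hb, false_and, false_or, or_false] at h
  cases k <;> simp [halfBlockNeighbors] at h ⊢ <;> tauto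

theorem eq_of_mem_halfBlock {V : Type*} {e b : V} {x : X → V} {u v : V}
    (h : s(u, v) ∈ halfBlock e b x) : u = e ∨ u = b ∨ ∃ k, u = x k := by
  simp only [halfBlock, Set.mem_insert_iff, Set.mem_singleton_iff, Sym2.eq_iff] at h
  rcases h with h | h | h | h | h | h | h | h | h | h | h | h | h <;>
    rcases h with h | h <;> rw [h.1] <;> simp

theorem eq_of_end_mem_halfBlock {V : Type*} {e b : V} {x : X → V} (he : ∀ k, e ≠ x k) (hb : e ≠ b)
    {v : V} (h : s(e, v) ∈ halfBlock e b x) : v = x .x1 ∨ v = x .x4 := by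
  simp only [halfBlock, Set.mem_insert_iff, Set.mem_singleton_iff, Sym2.eq_iff, he, hb,
    false_and, false_or, or_false, true_and] at h
  exact h

theorem rPath_of_lt {s : Side} {k : ℕ} (hk : k < m s) : rPath m s (k + 1) = .r s ⟨k, hk⟩ := by
  simp [rPath, hk]

theorem rPath_last (s : Side) : rPath m s (m s + 1) = .d := by
  simp [rPath]

theorem rPath_cases (s : Side) (k : ℕ) :
    (k = 0 ∧ rPath m s k = .c) ∨ (∃ j, ∃ h : j < m s, k = j + 1 ∧ rPath m s k = .r s ⟨j, h⟩) ∨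
      (m s < k ∧ rPath m s k = .d) := by
  rcases k with _ | k
  · exact .inl ⟨rfl, rfl⟩
  · by_cases h : k < m s
    · exact .inr (.inl ⟨k, h, rfl, rPath_of_lt h⟩)
    · refine .inr (.inr ⟨by omega, ?_⟩)
      simp [rPath, h]

theorem rPath_ne_j (s s' : Side) (k : ℕ) (x : X) : HVert.j s x ≠ rPath m s' k := by
  intro h
  rcases rPath_cases (m := m) s' k with h' | ⟨_, _, _, h'⟩ | h'
  · rw [h'.2] at h; cases h
  · rw [h'] at h; cases h
  · rw [h'.2] at h; cases h

theorem rPath_ne_l (s s' : Side) (k : ℕ) (x : X) : HVert.l s x ≠ rPath m s' k := by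
  intro h
  rcases rPath_cases (m := m) s' k with h' | ⟨_, _, _, h'⟩ | h'
  · rw [h'.2] at h; cases h
  · rw [h'] at h; cases h
  · rw [h'.2] at h; cases h

theorem H_adj {u v : HVert m} (h : (H m).Adj u v) :
    (∃ s, s(u, v) ∈ halfBlock .a .b (HVert.j s)) ∨ (∃ s, s(u, v) ∈ halfBlock .c .b (HVert.l s)) ∨
      ∃ s k, k ≤ m s ∧ ((u = rPath m s k ∧ v = rPath m s (k + 1)) ∨
        (v = rPath m s k ∧ u = rPath m s (k + 1))) := by
  rw [H, SimpleGraph.fromEdgeSet_adj] at h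
  rcases h.1 with (h | h) | ⟨s, k, hk, h⟩
  · exact .inl (Set.mem_iUnion.1 h)
  · exact .inr (.inl (Set.mem_iUnion.1 h))
  · refine .inr (.inr ⟨s, k, hk, ?_⟩)
    rw [Sym2.eq_iff] at h
    tauto

theorem H_adj_j {s : Side} {k : X} {v : HVert m} (h : (H m).Adj (.j s k) v) :
    v ∈ halfBlockNeighbors .a .b (HVert.j s) k := by
  rcases H_adj h with ⟨s', h⟩ | ⟨s', h⟩ | ⟨s', k', -, h⟩
  · obtain rfl : s = s' := by
      rcases eq_of_mem_halfBlock h with h | h | ⟨k, h⟩ <;> cases h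
      rfl
    exact mem_neighbors_of_mem_halfBlock (fun _ _ h => by cases h; rfl) (by simp) (by simp) h
  · rcases eq_of_mem_halfBlock h with h | h | ⟨k, h⟩ <;> cases h
  · rcases h with ⟨h, -⟩ | ⟨-, h⟩ <;> exact (rPath_ne_j _ _ _ _ h).elim

theorem H_adj_l {s : Side} {k : X} {v : HVert m} (h : (H m).Adj (.l s k) v) :
    v ∈ halfBlockNeighbors .c .b (HVert.l s) k := by
  rcases H_adj h with ⟨s', h⟩ | ⟨s', h⟩ | ⟨s', k', -, h⟩
  · rcases eq_of_mem_halfBlock h with h | h | ⟨k, h⟩ <;> cases h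
  · obtain rfl : s = s' := by
      rcases eq_of_mem_halfBlock h with h | h | ⟨k, h⟩ <;> cases h
      rfl
    exact mem_neighbors_of_mem_halfBlock (fun _ _ h => by cases h; rfl) (by simp) (by simp) h
  · rcases h with ⟨h, -⟩ | ⟨-, h⟩ <;> exact (rPath_ne_l _ _ _ _ h).elim

theorem H_adj_c {v : HVert m} (h : (H m).Adj .c v) :
    ∃ s, v = .l s .x1 ∨ v = .l s .x4 ∨ v = rPath m s 1 := by
  rcases H_adj h with ⟨s', h⟩ | ⟨s', h⟩ | ⟨s', k', -, h⟩
  · rcases eq_of_mem_halfBlock h with h | h | ⟨k, h⟩ <;> cases h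
  · rcases eq_of_end_mem_halfBlock (by simp) (by simp) h with h | h
    · exact ⟨s', .inl h⟩
    · exact ⟨s', .inr (.inl h)⟩
  · refine ⟨s', .inr (.inr ?_)⟩
    rcases h with ⟨h, h1⟩ | ⟨-, h⟩
    · rcases rPath_cases (m := m) s' k' with h' | ⟨_, _, _, h'⟩ | h'
      · rw [h1, h'.1]
      · simp_all
      · simp_all
    · rcases rPath_cases (m := m) s' (k' + 1) with h' | ⟨_, _, _, h'⟩ | h' <;> simp_all

theorem H_adj_r {s : Side} {j : ℕ} {hj : j < m s} {v : HVert m} (h : (H m).Adj (.r s ⟨j, hj⟩) v) :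
    v = rPath m s j ∨ v = rPath m s (j + 2) := by
  have key : ∀ {s' k'}, HVert.r s ⟨j, hj⟩ = rPath m s' k' → s' = s ∧ k' = j + 1 := by
    intro s' k' h
    rcases rPath_cases (m := m) s' k' with h' | ⟨i, hi, hk, h'⟩ | h'
    · rw [h'.2] at h; cases h
    · rw [h'] at h; cases h; exact ⟨rfl, hk⟩
    · rw [h'.2] at h; cases h
  rcases H_adj h with ⟨s', h⟩ | ⟨s', h⟩ | ⟨s', k', -, h⟩
  · rcases eq_of_mem_halfBlock h with h | h | ⟨k, h⟩ <;> cases h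
  · rcases eq_of_mem_halfBlock h with h | h | ⟨k, h⟩ <;> cases h
  · rcases h with ⟨h, h1⟩ | ⟨h1, h⟩
    · obtain ⟨rfl, rfl⟩ := key h
      exact .inr h1
    · obtain ⟨rfl, h2⟩ := key h
      obtain rfl : k' = j := by omega
      exact .inl h1

end HNeighbors

/-! ### One untouched gadget -/

/-- A copy of the gadget whose inner vertices have no neighbours in `C` outside the prism of the
copy. -/
structure IsUntouched {m : Side → ℕ} {V : Type*} (C : SimpleGraph (V × Fin 2))
    (φ : HVert m → V) : Prop where
  inj : Function.Injective φ
  adj : ∀ v ε w, C.Adj (φ (.inner v), ε) w →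
    w = (φ (.inner v), ε + 1) ∨ ∃ u, (H m).Adj (.inner v) u ∧ w = (φ u, ε)

namespace IsUntouched

variable {m : Side → ℕ} {V : Type*} {C : SimpleGraph (V × Fin 2)} {φ ψ : HVert m → V}

theorem halfBlock_j (hφ : IsUntouched C φ) (s : Side) :
    IsHalfBlock C (φ .a) (φ .b) (fun k => φ (.j s k)) := by
  refine ⟨fun _ _ h => (by cases hφ.inj h; rfl), fun k h => (by cases hφ.inj h),
    fun k h => (by cases hφ.inj h), fun h => (by cases hφ.inj h), fun k ε v hv => ?_⟩
  rcases hφ.adj _ _ _ hv with h | ⟨u, h, rfl⟩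
  · exact .inl h
  · refine .inr ⟨?_, rfl⟩
    have := List.mem_map_of_mem (f := φ) (H_adj_j h)
    cases k <;> exact this

theorem halfBlock_l (hφ : IsUntouched C φ) (s : Side) :
    IsHalfBlock C (φ .c) (φ .b) (fun k => φ (.l s k)) := by
  refine ⟨fun _ _ h => (by cases hφ.inj h; rfl), fun k h => (by cases hφ.inj h),
    fun k h => (by cases hφ.inj h), fun h => (by cases hφ.inj h), fun k ε v hv => ?_⟩
  rcases hφ.adj _ _ _ hv with h | ⟨u, h, rfl⟩
  · exact .inl h
  · refine .inr ⟨?_, rfl⟩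
    have := List.mem_map_of_mem (f := φ) (H_adj_l h)
    cases k <;> exact this

theorem isSegment (hφ : IsUntouched C φ) (s : Side) :
    IsSegment C (fun j => φ (rPath m s j)) (m s) := by
  constructor
  · intro j hj h
    have h := hφ.inj h
    rcases rPath_cases (m := m) s j with h1 | ⟨i, hi, hk, h1⟩ | h1 <;>
      rcases rPath_cases (m := m) s (j + 2) with h2 | ⟨i', hi', hk', h2⟩ | h2
    · omega
    · rw [h1.2, h2] at h; cases h
    · rw [h1.2, h2.2] at h; cases h
    · omega
    · rw [h1, h2] at h; cases h; omega
    · rw [h1, h2.2] at h; cases h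
    · omega
    · rw [h1.2, h2] at h; cases h
    · omega
  · intro j hj ε v hv
    rw [rPath_of_lt hj] at hv ⊢
    rcases hφ.adj _ _ _ hv with h | ⟨u, h, rfl⟩
    · exact .inl h
    · rcases H_adj_r h with rfl | rfl
      · exact .inr (.inl rfl)
      · exact .inr (.inr rfl)

/-- The copies of `b` have at most two neighbours in the four half blocks, and no others if there
are two of them. -/
theorem bDeg_sum_le (hC : IsSpanningCycle C) (hφ : IsUntouched C φ) (ε : Fin 2) :
    bDeg C (φ .b) (fun k => φ (.j .upper k)) ε + bDeg C (φ .b) (fun k => φ (.j .lower k)) ε +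
      bDeg C (φ .b) (fun k => φ (.l .upper k)) ε + bDeg C (φ .b) (fun k => φ (.l .lower k)) ε ≤ 2 ∧
    (bDeg C (φ .b) (fun k => φ (.j .upper k)) ε + bDeg C (φ .b) (fun k => φ (.j .lower k)) ε +
      bDeg C (φ .b) (fun k => φ (.l .upper k)) ε + bDeg C (φ .b) (fun k => φ (.l .lower k)) ε = 2 →
      ∀ w, C.Adj (φ .b, ε) w → ∃ s k, w.1 = φ (.j s k) ∨ w.1 = φ (.l s k)) := by
  let l : List (V × Fin 2) := [(φ (.j .upper .x4), ε), (φ (.j .upper .x7), ε),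
    (φ (.j .upper .x8), ε), (φ (.j .lower .x4), ε), (φ (.j .lower .x7), ε),
    (φ (.j .lower .x8), ε), (φ (.l .upper .x4), ε), (φ (.l .upper .x7), ε),
    (φ (.l .upper .x8), ε), (φ (.l .lower .x4), ε), (φ (.l .lower .x7), ε),
    (φ (.l .lower .x8), ε)]
  have hl : l.Nodup := by simp [l, hφ.inj.eq_iff]
  have hsum := hC.sum_le (φ .b, ε) l hl
  have hmem := fun w => hC.mem_of_sum (v := (φ .b, ε)) (w := w) l hl
  simp only [l, List.map_cons, List.map_nil, List.sum_cons, List.sum_nil] at hsum hmem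
  simp only [bDeg]
  refine ⟨by omega, fun h w hw => ?_⟩
  have := hmem w (by omega) hw
  simp only [List.mem_cons, List.not_mem_nil, or_false] at this
  rcases this with rfl | rfl | rfl | rfl | rfl | rfl | rfl | rfl | rfl | rfl | rfl | rfl
  all_goals first | exact ⟨_, _, .inl rfl⟩ | exact ⟨_, _, .inr rfl⟩

/-- Four half blocks each need one of the four edge ends at the copies of `b`, so each takes exactly
one and `b` has no other edges; `even_deg` then makes the count at the other end odd. -/
theorem deg_facts (hC : IsSpanningCycle C) (hφ : IsUntouched C φ) :
    (∀ s, (eDeg C (φ .a) (fun k => φ (.j s k)) 0 + eDeg C (φ .a) (fun k => φ (.j s k)) 1) % 2 = 1) ∧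
    (∀ s, (eDeg C (φ .c) (fun k => φ (.l s k)) 0 + eDeg C (φ .c) (fun k => φ (.l s k)) 1) % 2 = 1) ∧
    ∀ ε w, C.Adj (φ .b, ε) w → ∃ s k, w.1 = φ (.j s k) ∨ w.1 = φ (.l s k) := by
  have hj := fun s => (hφ.halfBlock_j s).bDeg_pos hC
  have hl := fun s => (hφ.halfBlock_l s).bDeg_pos hC
  have hj' := fun s => (hφ.halfBlock_j s).even_deg hC
  have hl' := fun s => (hφ.halfBlock_l s).even_deg hC
  have h0 := hφ.bDeg_sum_le hC 0
  have h1 := hφ.bDeg_sum_le hC 1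
  have hju := hj .upper
  have hjl := hj .lower
  have hlu := hl .upper
  have hll := hl .lower
  refine ⟨fun s => ?_, fun s => ?_, ?_⟩
  · have := hj' s
    cases s <;> omega
  · have := hl' s
    cases s <;> omega
  · exact Fin.forall_fin_two.2 ⟨h0.2 (by omega), h1.2 (by omega)⟩

theorem fst_ne_of_mem_segSet (φ : HVert m → V) (s : Side) {z : V × Fin 2} (hz : ∀ u, z.1 ≠ φ u) :
    z ∉ segSet (fun j => φ (rPath m s j)) (m s) := by
  rintro ⟨j, -, h⟩
  exact hz _ h

/-- The cycle `C` cannot leave a set `Z` only through an untouched gadget. -/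
theorem false_of_entrance (hC : IsSpanningCycle C) (hm : ∀ s, 1 ≤ m s)
    (hodd : Odd (m .upper + m .lower)) (hφ : IsUntouched C φ) (Z : Set (V × Fin 2))
    {z : V × Fin 2} (hzZ : z ∉ Z) (hz : ∀ u, z.1 ≠ φ u)
    (hZ : ∀ v ∈ Z, ∀ w, C.Adj v w → w ∈ Z ∨ ∃ s k, w.1 = φ (.j s k))
    (hZa : ∀ w, w.1 = φ .a → (∃ s, 1 ≤ eDeg C (φ .a) (fun k => φ (.j s k)) w.2) → w ∈ Z) :
    False := by
  obtain ⟨-, hl, hb⟩ := hφ.deg_facts hC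
  let T : Set (V × Fin 2) := {v | v ∈ Z ∨ (∃ s k, v.1 = φ (.j s k)) ∨ v.1 = φ .b ∨
    ∃ s k, v.1 = φ (.l s k)}
  have hzT : z ∉ T := by
    rintro (h | ⟨s, k, h⟩ | h | ⟨s, k, h⟩)
    exacts [hzZ h, hz _ h, hz _ h, hz _ h]
  have hT : ∀ v ∈ T, ∀ w, C.Adj v w →
      w ∈ T ∨ (w.1 = φ .c ∧ ∃ s, 1 ≤ eDeg C (φ .c) (fun k => φ (.l s k)) w.2) := by
    rintro ⟨v, ε⟩ (hv | ⟨s, k, hv⟩ | hv | ⟨s, k, hv⟩) w hw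
    · rcases hZ _ hv _ hw with h | h
      · exact .inl (.inl h)
      · exact .inl (.inr (.inl h))
    · obtain rfl : v = φ (.j s k) := hv
      rcases (hφ.halfBlock_j s).exit hw with ⟨k', h⟩ | h | h
      · exact .inl (.inr (.inl ⟨s, k', h⟩))
      · exact .inl (.inr (.inr (.inl h)))
      · exact .inl (.inl (hZa w h.1 ⟨s, h.2⟩))
    · obtain rfl : v = φ .b := hv
      obtain ⟨s, k, h | h⟩ := hb _ _ hw
      · exact .inl (.inr (.inl ⟨s, k, h⟩))
      · exact .inl (.inr (.inr (.inr ⟨s, k, h⟩)))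
    · obtain rfl : v = φ (.l s k) := hv
      rcases (hφ.halfBlock_l s).exit hw with ⟨k', h⟩ | h | h
      · exact .inl (.inr (.inr (.inr ⟨s, k', h⟩)))
      · exact .inl (.inr (.inr (.inl h)))
      · exact .inr ⟨h.1, s, h.2⟩
  let l : Fin 2 → List (V × Fin 2) := fun ε => [(φ (.l .upper .x1), ε), (φ (.l .upper .x4), ε),
    (φ (.l .lower .x1), ε), (φ (.l .lower .x4), ε)]
  have hlnd : ∀ ε, (l ε).Nodup := fun ε => by simp [l, hφ.inj.eq_iff]
  have hlsum : ∀ ε, ((l ε).map (ind C (φ .c, ε))).sum =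
      eDeg C (φ .c) (fun k => φ (.l .upper k)) ε + eDeg C (φ .c) (fun k => φ (.l .lower k)) ε := by
    intro ε
    simp only [l, List.map_cons, List.map_nil, List.sum_cons, List.sum_nil, eDeg]
    omega
  have hle : ∀ ε, ((l ε).map (ind C (φ .c, ε))).sum ≤ 2 := fun ε => hC.sum_le _ _ (hlnd ε)
  have hlT : ∀ ε, ∀ w ∈ l ε, w ∈ T := by
    intro ε w hw
    simp only [l, List.mem_cons, List.not_mem_nil, or_false] at hw
    rcases hw with rfl | rfl | rfl | rfl <;> exact .inr (.inr (.inr ⟨_, _, rfl⟩))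
  have hle0 := hle 0
  have hle1 := hle 1
  have hlu := hl .upper
  have hll := hl .lower
  -- Two odd counts make the total number of edges from `L` to the copies of `c` even and positive.
  -- Either each copy gets one, and the odd cycle `R` is impossible, or each gets 0 or 2, and adding
  -- the saturated copies to `T` closes it.
  by_cases hone : ∀ ε, ((l ε).map (ind C (φ .c, ε))).sum = 1
  · have r0 : ∀ s, rPath m s 1 = .r s ⟨0, hm s⟩ := fun s => rPath_of_lt (hm s)
    have rlast : ∀ s, rPath m s (m s) = .r s ⟨m s - 1, by have := hm s; omega⟩ := fun s => by
      have := rPath_of_lt (m := m) (s := s) (k := m s - 1) (by have := hm s; omega)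
      rwa [Nat.sub_add_cancel (hm s)] at this
    have hcadj : ∀ ε v, C.Adj (φ .c, ε) v → v = (φ .c, ε + 1) ∨ v ∈ l ε ∨
        v = (φ (rPath m .upper 1), ε) ∨ v = (φ (rPath m .lower 1), ε) := by
      intro ε v hv
      rcases hφ.adj _ _ _ hv with h | ⟨u, h, rfl⟩
      · exact .inl h
      · obtain ⟨s, rfl | rfl | rfl⟩ := H_adj_c h <;> cases s <;> simp [l]
    refine false_of_odd_cycle hC (hφ.isSegment .upper) (hφ.isSegment .lower) (hm _) (hm _)
      (Nat.odd_iff.1 hodd) (c := φ .c) (d := φ .d) rfl rfl (by simp only [rPath_last])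
      (by simp only [rPath_last]) (by simp only [rlast]; intro h; cases hφ.inj h) T
      (fun v hv w hw => (hT v hv w hw).imp_right And.left) ?_ ?_ hzT (hz _) (hz _)
      (fst_ne_of_mem_segSet φ _ hz) (fst_ne_of_mem_segSet φ _ hz)
    · intro ε v hv
      rcases hcadj ε v hv with rfl | h | h | h
      · exact .inr (.inl rfl)
      · exact .inl (hlT _ _ h)
      · exact .inr (.inr (.inl h))
      · exact .inr (.inr (.inr h))
    · intro ε
      have h := hC.sum_eq (φ .c, ε) ((φ .c, ε + 1) :: (φ (rPath m .upper 1), ε) ::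
        (φ (rPath m .lower 1), ε) :: l ε) ?_ ?_
      · simp only [List.map_cons, List.sum_cons, hone] at h
        omega
      · simp only [r0]
        simp [l, hφ.inj.eq_iff]
      · intro w hw
        have := hcadj ε w hw
        simp only [List.mem_cons]
        tauto
  · rw [Fin.forall_fin_two, hlsum, hlsum] at hone
    rw [hlsum] at hle0 hle1
    refine hC.false_of_closed (T ∪ {v | v.1 = φ .c ∧ ((l v.2).map (ind C (φ .c, v.2))).sum = 2})
      (u := (φ .b, 0)) (z := z) (.inl (.inr (.inr (.inl rfl)))) ?_ ?_
    · rintro (h | h)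
      exacts [hzT h, hz _ h.1]
    · rintro ⟨v, ε⟩ (hv | ⟨rfl, hv⟩) w hw
      · rcases hT _ hv w hw with h | ⟨h, s, h'⟩
        · exact .inl h
        · refine .inr ⟨h, ?_⟩
          have h2 : 1 ≤ ((l w.2).map (ind C (φ .c, w.2))).sum := by
            rw [hlsum]
            cases s <;> omega
          have h3 : ∀ ε, ((l ε).map (ind C (φ .c, ε))).sum ≠ 1 := by
            refine Fin.forall_fin_two.2 ⟨?_, ?_⟩ <;> rw [hlsum] <;> omega
          have := h3 w.2
          have := hle w.2
          omega
      · exact .inl (hlT ε w (hC.mem_of_sum (l ε) (hlnd ε) (le_of_eq hv.symm) hw))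

end IsUntouched

/-! ### Two consecutive untouched gadgets -/

theorem Side.eq_of_ne {s t r : Side} (hst : s ≠ t) (hrs : r ≠ s) : r = t := by
  cases s <;> cases t <;> cases r <;> first | rfl | exact (hst rfl).elim | exact (hrs rfl).elim

namespace IsUntouched

variable {m : Side → ℕ} {V : Type*} {C : SimpleGraph (V × Fin 2)} {φ ψ : HVert m → V}

set_option maxHeartbeats 1000000 in
/-- Two consecutive copies of the gadget cannot both be untouched. -/
theorem false_of_consecutive (hC : IsSpanningCycle C) (hm : ∀ s, 1 ≤ m s)
    (hodd : Odd (m .upper + m .lower)) (hφ : IsUntouched C φ) (hψ : IsUntouched C ψ)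
    (hd : φ .d = ψ .a) (hdisj : ∀ u v, φ u = ψ v → u = .d)
    {z : V × Fin 2} (hzφ : ∀ u, z.1 ≠ φ u) (hzψ : ∀ u, z.1 ≠ ψ u) : False := by
  obtain ⟨-, hL, -⟩ := hφ.deg_facts hC
  obtain ⟨hJ, -, -⟩ := hψ.deg_facts hC
  have hLu := hL .upper
  have hLl := hL .lower
  have hJu := hJ .upper
  have hJl := hJ .lower
  rw [← hd] at hJu hJl
  have first : ∀ s, rPath m s 1 = .r s ⟨0, hm s⟩ := fun s => rPath_of_lt (hm s)
  have last : ∀ s, rPath m s (m s) = .r s ⟨m s - 1, by have := hm s; omega⟩ := fun s => by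
    have := rPath_of_lt (m := m) (s := s) (k := m s - 1) (by have := hm s; omega)
    rwa [Nat.sub_add_cancel (hm s)] at this
  let U : Side → ℕ → V := fun s j => φ (rPath m s j)
  have hU : ∀ s, IsSegment C (U s) (m s) := fun s => hφ.isSegment s
  have hUc : ∀ s, U s 0 = φ .c := fun s => rfl
  have hUd : ∀ s, U s (m s + 1) = φ .d := fun s => congrArg φ (rPath_last s)
  have hzU : ∀ s, z ∉ segSet (U s) (m s) := fun s => fst_ne_of_mem_segSet φ s hzφ
  have mem1 : ∀ s ε, ((U s 1, ε) : V × Fin 2) ∈ segSet (U s) (m s) := fun s ε => ⟨0, hm s, rfl⟩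
  have mem2 : ∀ s ε, ((U s (m s), ε) : V × Fin 2) ∈ segSet (U s) (m s) := fun s ε =>
    ⟨m s - 1, by have := hm s; omega, by rw [Nat.sub_add_cancel (hm s)]⟩
  let J : Fin 2 → ℕ := fun ε => eDeg C (φ .d) (fun k => ψ (.j .upper k)) ε +
    eDeg C (φ .d) (fun k => ψ (.j .lower k)) ε
  let l : Fin 2 → List (V × Fin 2) := fun ε => [(ψ (.j .upper .x1), ε), (ψ (.j .upper .x4), ε),
    (ψ (.j .lower .x1), ε), (ψ (.j .lower .x4), ε)]
  have hlnd : ∀ ε, (l ε).Nodup := fun ε => by simp [l, hψ.inj.eq_iff]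
  have hlsum : ∀ ε, ((l ε).map (ind C (φ .d, ε))).sum = J ε := by
    intro ε
    simp only [l, J, List.map_cons, List.map_nil, List.sum_cons, List.sum_nil, eDeg]
    omega
  have hlmem : ∀ ε, ∀ w ∈ l ε, ∃ s k, w.1 = ψ (.j s k) := by
    intro ε w hw
    simp only [l, List.mem_cons, List.not_mem_nil, or_false] at hw
    rcases hw with rfl | rfl | rfl | rfl <;> exact ⟨_, _, rfl⟩
  have hUl : ∀ s ε ε', ((U s (m s), ε) : V × Fin 2) ∉ l ε' := by
    intro s ε ε' h
    obtain ⟨s', k, h⟩ := hlmem _ _ h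
    have := hdisj _ _ h
    rw [last] at this
    cases this
  have hUne : U .upper (m .upper) ≠ U .lower (m .lower) := by
    intro h
    have := hφ.inj h
    rw [last, last] at this
    cases this
  have hUne' : U .upper 1 ≠ U .lower 1 := by
    intro h
    have := hφ.inj h
    rw [first, first] at this
    cases this
  have hdnd : ∀ ε, ((U .upper (m .upper), ε) :: (U .lower (m .lower), ε) :: l ε).Nodup := by
    intro ε
    refine List.nodup_cons.2 ⟨?_, List.nodup_cons.2 ⟨hUl _ _ _, hlnd ε⟩⟩
    rw [List.mem_cons]
    rintro (h | h)
    · exact hUne (congrArg Prod.fst h)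
    · exact hUl _ _ _ h
  have hdsum : ∀ ε, (((U .upper (m .upper), ε) :: (U .lower (m .lower), ε) :: l ε).map
      (ind C (φ .d, ε))).sum =
      edgeInd C (U .upper) (m .upper) ε + edgeInd C (U .lower) (m .lower) ε + J ε := by
    intro ε
    rw [List.map_cons, List.map_cons, List.sum_cons, List.sum_cons, hlsum, edgeInd, edgeInd, hUd,
      hUd, ind_comm C (φ .d, ε), ind_comm C (φ .d, ε)]
    omega
  have hdle : ∀ ε, edgeInd C (U .upper) (m .upper) ε + edgeInd C (U .lower) (m .lower) ε + J ε ≤ 2 :=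
    fun ε => hdsum ε ▸ hC.sum_le _ _ (hdnd ε)
  have hdexit : ∀ ε, edgeInd C (U .upper) (m .upper) ε + edgeInd C (U .lower) (m .lower) ε + J ε = 2 →
      ∀ w, C.Adj (φ .d, ε) w → (∃ s, w = (U s (m s), ε)) ∨ ∃ s k, w.1 = ψ (.j s k) := by
    intro ε h w hw
    have := hC.mem_of_sum _ (hdnd ε) (by rw [hdsum]; omega) hw
    rw [List.mem_cons, List.mem_cons] at this
    rcases this with h | h | h
    · exact .inl ⟨_, h⟩
    · exact .inl ⟨_, h⟩
    · exact .inr (hlmem _ _ h)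
  have hcle : ∀ ε, edgeInd C (U .upper) 0 ε + edgeInd C (U .lower) 0 ε +
      (eDeg C (φ .c) (fun k => φ (.l .upper k)) ε +
        eDeg C (φ .c) (fun k => φ (.l .lower k)) ε) ≤ 2 := by
    intro ε
    have := hC.sum_le (φ .c, ε) [(U .upper 1, ε), (U .lower 1, ε), (φ (.l .upper .x1), ε),
      (φ (.l .upper .x4), ε), (φ (.l .lower .x1), ε), (φ (.l .lower .x4), ε)]
      (by simp only [U, first]; simp [hφ.inj.eq_iff])
    simp only [List.map_cons, List.map_nil, List.sum_cons, List.sum_nil] at this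
    simp only [edgeInd, hUc, zero_add, eDeg]
    omega
  have hend : ∀ Z : Set (V × Fin 2), z ∉ Z →
      (∀ v ∈ Z, ∀ w, C.Adj v w → w ∈ Z ∨ ∃ s k, w.1 = ψ (.j s k)) →
      (∀ ε, 1 ≤ J ε → (φ .d, ε) ∈ Z) → False := by
    intro Z hz h1 h2
    refine hψ.false_of_entrance hC hm hodd Z hz hzψ h1 ?_
    rintro ⟨w, ε⟩ hw ⟨s, hs⟩
    obtain rfl : w = ψ .a := hw
    rw [← hd] at hs ⊢
    replace hs : 1 ≤ eDeg C (φ .d) (fun k => ψ (.j s k)) ε := hs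
    refine h2 ε ?_
    cases s <;> simp only [J] <;> omega
  -- Here side `s` hangs only from `c` and side `t` only from `d`; side `t` with the saturated
  -- copies of `d` can be left only into the next block `J`.
  have split : ∀ s t, s ≠ t → (∀ ε, edgeInd C (U s) (m s) ε = 0) →
      (∀ ε, edgeInd C (U t) 0 ε = 0) → (∀ ε, edgeInd C (U .upper) (m .upper) ε +
        edgeInd C (U .lower) (m .lower) ε + J ε = 2) → False := by
    intro s t hst h1 h2 h3
    refine hend (segSet (U t) (m t) ∪ {v | v.1 = φ .d}) ?_ ?_ (fun ε _ => .inr rfl)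
    · rintro (h | h)
      exacts [hzU _ h, hzφ _ h]
    · rintro ⟨v, ε⟩ (hv | rfl) w hw
      · rcases (hU t).exit hv hw with h | h | h
        · exact .inl (.inl h)
        · have := h2 w.2
          omega
        · exact .inl (.inr (by rw [h.1, hUd]; rfl))
      · rcases hdexit ε (h3 ε) w hw with ⟨s', rfl⟩ | h
        · by_cases hs : s' = s
          · subst hs
            have := h1 ε
            rw [edgeInd, hUd] at this
            exact (not_adj_of_ind this hw.symm).elim
          · obtain rfl := Side.eq_of_ne hst hs
            exact .inl (.inl (mem2 _ _))
        · exact .inr h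
  have hc0 := hcle 0
  have hc1 := hcle 1
  have hd0 := hdle 0
  have hd1 := hdle 1
  have hJ2 : 2 ≤ J 0 + J 1 ∧ (J 0 + J 1) % 2 = 0 := by
    simp only [J]
    omega
  have hp := Nat.odd_iff.1 hodd
  -- The neighbouring block takes at least two of the four edge ends at the copies of `c`, and
  -- likewise at `d`, so `R` has at most two at each. Only the split patterns and the one with a
  -- single edge on each side survive.
  rcases (hU .upper).cases hC (hm _) (hzU _) with h | h | h <;>
    rcases (hU .lower).cases hC (hm _) (hzU _) with h' | h' | h'
  · omega
  · exact split .upper .lower (by simp) (Fin.forall_fin_two.2 ⟨by omega, by omega⟩)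
      (Fin.forall_fin_two.2 ⟨by omega, by omega⟩) (Fin.forall_fin_two.2 ⟨by omega, by omega⟩)
  · omega
  · exact split .lower .upper (by simp) (Fin.forall_fin_two.2 ⟨by omega, by omega⟩)
      (Fin.forall_fin_two.2 ⟨by omega, by omega⟩) (Fin.forall_fin_two.2 ⟨by omega, by omega⟩)
  · omega
  · omega
  · omega
  · omega
  -- Same layer at `c`: that copy of `c` is saturated by `R`, and by odd parity the paths reach
  -- different copies of `d`, each then with one edge into the next `J`. Different layers at `c`:
  -- both paths reach the same copy of `d`, and the other copy has both its edges in the next `J`.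
  · by_cases heq : edgeInd C (U .upper) 0 0 = edgeInd C (U .lower) 0 0
    · have heq' : ∀ ε, edgeInd C (U .upper) 0 ε = edgeInd C (U .lower) 0 ε :=
        Fin.forall_fin_two.2 ⟨heq, by omega⟩
      have hd2 : ∀ ε, edgeInd C (U .upper) (m .upper) ε +
          edgeInd C (U .lower) (m .lower) ε + J ε = 2 :=
        Fin.forall_fin_two.2 ⟨by omega, by omega⟩
      refine hend ({v | v.1 = φ .c ∧ edgeInd C (U .upper) 0 v.2 = 1} ∪
        {v | ∃ s, v ∈ segSet (U s) (m s)} ∪ {v | v.1 = φ .d}) ?_ ?_ (fun ε _ => .inr rfl)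
      · rintro ((h | ⟨s, h⟩) | h)
        exacts [hzφ _ h.1, hzU _ h, hzφ _ h]
      · rintro ⟨v, ε⟩ ((⟨rfl, hv⟩ | ⟨s, hv⟩) | rfl) w hw
        · have hv' := hv
          rw [heq'] at hv'
          rw [edgeInd, hUc] at hv hv'
          have := hC.mem_of_sum (v := (φ .c, ε)) [(U .upper 1, ε), (U .lower 1, ε)]
            (by simp [hUne']) (by
              simp only [List.map_cons, List.map_nil, List.sum_cons, List.sum_nil]
              simp only [zero_add] at hv hv'
              omega) hw
          simp only [List.mem_cons, List.not_mem_nil, or_false] at this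
          rcases this with rfl | rfl <;> exact .inl (.inl (.inr ⟨_, mem1 _ _⟩))
        · rcases (hU s).exit hv hw with h | h | h
          · exact .inl (.inl (.inr ⟨s, h⟩))
          · refine .inl (.inl (.inl ⟨by rw [h.1, hUc], ?_⟩))
            cases s
            · exact h.2.1
            · rw [heq']; exact h.2.1
          · exact .inl (.inr (by rw [h.1, hUd]; rfl))
        · rcases hdexit ε (hd2 ε) w hw with ⟨s, rfl⟩ | h
          · exact .inl (.inl (.inr ⟨s, mem2 _ _⟩))
          · exact .inr h
    · refine hend {v | v.1 = φ .d ∧ J v.2 = 2} (fun h => hzφ _ h.1) ?_ ?_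
      · rintro ⟨v, ε⟩ ⟨rfl, hv⟩ w hw
        exact .inr (hlmem _ _ (hC.mem_of_sum (l ε) (hlnd ε) (by rw [hlsum]; exact hv.ge) hw))
      · exact Fin.forall_fin_two.2 ⟨fun h => ⟨rfl, by simp only; omega⟩, fun h => ⟨rfl, by simp only; omega⟩⟩

end IsUntouched
-- From a Hamilton cycle to an untouched pair
section Final

theorem isSpanningCycle_of_isHamiltonianCycle {W : Type*} {_ : DecidableEq W} {G : SimpleGraph W}
    {v : W} {w : G.Walk v v} (hw : w.IsHamiltonianCycle) :
    ∃ C : SimpleGraph W, C ≤ G ∧ IsSpanningCycle C := by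
  have hmem : ∀ u, u ∈ w.toSubgraph.verts := fun u => by
    rw [SimpleGraph.Walk.mem_verts_toSubgraph]
    exact hw.mem_support u
  refine ⟨w.toSubgraph.spanningCoe, w.toSubgraph.spanningCoe_le, ?_, ?_⟩
  · intro u
    exact hw.isCycle.ncard_neighborSet_toSubgraph_eq_two (hw.mem_support u)
  · rintro S ⟨a, ha⟩ ⟨b, hb⟩
    have hconn := w.toSubgraph_connected
    by_contra! hS
    have key : ∀ x y : w.toSubgraph.verts, w.toSubgraph.coe.Reachable x y → x.1 ∈ S → y.1 ∈ S := by
      rintro x y ⟨p⟩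
      induction p with
      | nil => exact id
      | cons h p ih => exact fun hx => ih (by_contra fun hn => hS _ hx _ hn h)
    exact hb (key ⟨a, hmem a⟩ ⟨b, hmem b⟩ (hconn.coe.preconnected _ _) ha)

variable {m : Side → ℕ} {n : ℕ}

theorem copy_injective (i : Fin n) : Function.Injective (copy (m := m) i) := by
  intro u v h
  cases u <;> cases v <;> simp [copy, Fin.ext_iff] at h ⊢
  exact h

theorem apex_ne_copy (s : Side) (i : Fin n) (u : HVert m) : apex s ≠ copy i u := by
  cases s <;> cases u <;> simp [apex, copy]

theorem G_adj_inner {i : Fin n} {v : Inner m} {w : GVert m n}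
    (h : (G m n).Adj (.inner i v) w) :
    (∃ s, w = apex s) ∨ ∃ u, (H m).Adj (.inner v) u ∧ w = copy i u := by
  rw [G, SimpleGraph.sup_adj, SimpleGraph.iSup_adj] at h
  rcases h with ⟨i', h⟩ | h
  · rw [SimpleGraph.map_adj'] at h
    obtain ⟨-, u, u', huu', hu, rfl⟩ := h
    cases u with
    | a => cases hu
    | d => cases hu
    | inner v' => cases hu; exact .inr ⟨u', huu', rfl⟩
  · rw [SimpleGraph.fromEdgeSet_adj] at h
    obtain ⟨⟨s, i', u, -, h⟩, -⟩ := h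
    rw [Sym2.eq_iff] at h
    rcases h with h | h
    · cases s <;> cases h.1
    · exact .inl ⟨s, h.2⟩

theorem isUntouched_copy {C : SimpleGraph (GVert m n × Fin 2)}
    (hCG : C ≤ (G m n).boxProd (⊤ : SimpleGraph (Fin 2))) {i : Fin n}
    (h : ∀ v ε s ε', ¬ C.Adj (.inner i v, ε) (apex s, ε')) : IsUntouched C (copy (m := m) i) := by
  refine ⟨copy_injective i, fun v ε w hw => ?_⟩
  obtain ⟨w, ε'⟩ := w
  rcases SimpleGraph.boxProd_adj.1 (hCG hw) with ⟨h1, h2⟩ | ⟨h1, h2⟩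
  · obtain rfl : ε = ε' := h2
    rcases G_adj_inner h1 with ⟨s, rfl⟩ | ⟨u, hu, rfl⟩
    · exact (h _ _ _ _ hw).elim
    · exact .inr ⟨u, hu, rfl⟩
  · left
    obtain rfl : copy i (.inner v) = w := h2
    have h3 : ε ≠ ε' := h1
    have h4 : ∀ a b : Fin 2, a ≠ b → b = a + 1 := by decide
    rw [h4 _ _ h3]

/-- The copies of the two apices have at most eight neighbours in `C`. -/
theorem ncard_apex_neighbors_le {C : SimpleGraph (GVert m n × Fin 2)} (hC : IsSpanningCycle C) :
    {w | ∃ s ε, C.Adj (apex s, ε) w}.Finite ∧ {w | ∃ s ε, C.Adj (apex s, ε) w}.ncard ≤ 8 := by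
  have h : {w | ∃ s ε, C.Adj (apex s, ε) w} =
      (C.neighborSet (apex .upper, 0) ∪ C.neighborSet (apex .upper, 1)) ∪
      (C.neighborSet (apex .lower, 0) ∪ C.neighborSet (apex .lower, 1)) := by
    ext w
    constructor
    · rintro ⟨s, ε, h⟩
      cases s <;> fin_cases ε
      exacts [.inl (.inl h), .inl (.inr h), .inr (.inl h), .inr (.inr h)]
    · rintro ((h | h) | (h | h)) <;> exact ⟨_, _, h⟩
  rw [h]
  have f := hC.finite_neighborSet
  refine ⟨((f _).union (f _)).union ((f _).union (f _)), ?_⟩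
  have h1 := Set.ncard_union_le (C.neighborSet (apex .upper, 0) ∪ C.neighborSet (apex .upper, 1))
    (C.neighborSet (apex .lower, 0) ∪ C.neighborSet (apex .lower, 1))
  have h2 := Set.ncard_union_le (C.neighborSet (apex .upper, 0)) (C.neighborSet (apex .upper, 1))
  have h3 := Set.ncard_union_le (C.neighborSet (apex .lower, 0)) (C.neighborSet (apex .lower, 1))
  simp only [hC.ncard_eq] at h2 h3
  omega

theorem exists_untouched_pair {C : SimpleGraph (GVert m n × Fin 2)}
    (hCG : C ≤ (G m n).boxProd (⊤ : SimpleGraph (Fin 2))) (hC : IsSpanningCycle C) (hn : 25 < n) :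
    ∃ i j : Fin n, i.val + 1 = j.val ∧ IsUntouched C (copy (m := m) i) ∧
      IsUntouched C (copy (m := m) j) := by
  by_contra! hno
  -- Pair `k` consists of the gadgets `2k` and `2k + 1`, and 13 pairs fit since `n ≥ 26`; the count
  -- only needs more than 8.
  have key : ∀ k : Fin 13, ∃ w : GVert m n × Fin 2, (∃ s ε, C.Adj (apex s, ε) w) ∧
      ∃ (i : Fin n) (v : Inner m), w.1 = .inner i v ∧ i.val / 2 = k.val := by
    intro k
    by_contra! hk
    have hi : ∀ i : Fin n, i.val / 2 = k.val → IsUntouched C (copy (m := m) i) := fun i hi =>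
      isUntouched_copy hCG fun v ε s ε' h => hk _ ⟨s, ε', h.symm⟩ i v rfl hi
    exact hno ⟨2 * k, by omega⟩ ⟨2 * k + 1, by omega⟩ rfl (hi _ (by simp)) (hi _ (by simp; omega))
  choose f hf i v hfi hi using key
  have hinj : Function.Injective f := by
    intro a b hab
    have h1 := hfi a
    rw [hab, hfi b] at h1
    injection h1 with h1 _
    have h2 := hi a
    rw [← h1, hi b] at h2
    exact Fin.ext h2.symm
  obtain ⟨hfin, hle⟩ := ncard_apex_neighbors_le hC
  have h := Set.ncard_le_ncard (s := Set.range f) (by rintro _ ⟨k, rfl⟩; exact hf k) hfin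
  rw [← Set.image_univ, Set.ncard_image_of_injective _ hinj, Set.ncard_univ] at h
  rw [Nat.card_eq_fintype_card, Fintype.card_fin] at h
  omega

end Final

end PrismCounterexample

theorem mainTheorem1 (m : PrismCounterexample.Side → ℕ) (hm : ∀ s, 1 ≤ m s)
    (hodd : Odd (m .upper + m .lower)) (n : ℕ) (hn : 25 < n) :
    ¬ PrismCounterexample.IsPrismHamiltonian (PrismCounterexample.G m n) := by
  classical
  rintro ⟨v, w, hw⟩
  obtain ⟨C, hCG, hC⟩ := PrismCounterexample.isSpanningCycle_of_isHamiltonianCycle hw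
  obtain ⟨i, j, hij, hi, hj⟩ := PrismCounterexample.exists_untouched_pair hCG hC hn
  refine hi.false_of_consecutive hC hm hodd hj ?_ ?_
    (z := ((PrismCounterexample.apex .upper : PrismCounterexample.GVert m n), 0))
    (PrismCounterexample.apex_ne_copy (m := m) (n := n) .upper i)
    (PrismCounterexample.apex_ne_copy (m := m) (n := n) .upper j)
  · simp [PrismCounterexample.copy, Fin.ext_iff, hij]
  · intro u v h
    cases u <;> cases v <;> simp [PrismCounterexample.copy, Fin.ext_iff] at h ⊢ <;> omega
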